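/- Time is slotted, $t=1,2,\dots$. A machine serves users $1,\dots,N$, each with its own job queue; a central server assigns the jobs. At the beginning of each slot the machine is internally busy, free, or processing a job of some user. Let $q,s,\mu\in(0,1]$ and $q_i\in(0,1]$ for every user $i$, let $\mathcal S\subseteq\{1,\dots,N\}$ be non-empty, and let $\pi$ be a probability distribution on the users with $\pi_i>0$ for $i\in\mathcal S$ and $\pi_i=0$ for $i\notin\mathcal S$. The system runs under the stationary randomized policy $\phi=(\mu,\pi)$. At the beginning of each slot in which the machine is not processing a user's job, the server samples the state of the machine with probability $\mu$; if the machine is sampled and found free, a user $i$ is drawn from $\pi$ and a job of user $i$ (if its queue is non-empty) is assigned at once and is processed from this slot on. At the end of each slot, a job of user $i$ in process is completed with probability $q_i$, and upon completion the machine becomes internally busy with probability $s$ and free with probability $1-s$; a machine that processed no user's job during the slot switches between internally busy and free with probability $q$. All these random choices are mutually independent. With $b_i(t)\in\{0,1\}$ the indicator that a job of user $i$ is completed in slot $t$ and $a_i(t)$ the number of jobs of user $i$ arriving at the end of slot $t$, the queue lengths satisfy $Q_i(t+1)=\max\{Q_i(t)-b_i(t),0\}+a_i(t)$. The initial state of the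 system and the last completion time before slot $1$ of each user are arbitrary and deterministic. Assume that the arrivals (an arbitrary process) are such that, almost surely, $Q_i(t)>0$ for all $t\ge1$ and all $i\in\mathcal S$. Let $v_k(t)=t-\sup\{t'<t: b_k(t')=1\}$ be the age of job completion of user $k$. Then for every $k\in\mathcal S$ the average age $\Delta_k=\limsup_{T\to\infty}\frac1T\sum_{t=1}^T\mathbb E[v_k(t)]$ is finite and $$ \Delta_k=\frac{1}{\frac sq+2\left(\frac1\mu-1\right)+\bar\eta}\Bigg(\frac{\psi_k^2}{\pi_k}+\Big(\frac1{q_k}+\frac{1-s}{q}-2\Big)\psi_k+\frac1q\Big((1-s)(1-\pi_k-\eta_k)-\frac1\mu\Big)-\frac{\pi_k(1-q_k)}{q_k}+\sum_{i\in\mathcal S}\frac{\pi_i(1-q_i)}{q_i^2}\Bigg)+1, $$ where $\bar\eta=\sum_{i\in\mathcal S}\frac{\pi_i}{q_i}$, $\eta_k=\bar\eta-\frac{\pi_k}{q_k}$ and $\psi_k=\eta_k+\pi_k+2\left(\frac1\mu-1\right)+\frac sq$. -/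

import Mathlib

open MeasureTheory ProbabilityTheory Filter
open scoped ENNReal

/-- The states of the machine: internally busy, free, or processing a job of user `i`. -/
inductive MachineState (N : ℕ) : Type
  | busy : MachineState N
  | free : MachineState N
  | serving (i : Fin N) : MachineState N

/-- The state of the system at the beginning of a slot, before the server acts: the actual state of
the machine and the queue lengths. -/
structure SystemState (N : ℕ) where
  machine : MachineState N
  queue : Fin N → ℕ

/-- The random outcomes of one slot: sampling decision, scheduled user, transition between the
internally busy and the free state, transition to the internally busy state upon a completion,
and, for each user, completion of its job. -/
abbrev SlotNoise (N : ℕ) : Type := Bool × Fin N × Bool × Bool × (Fin N → Bool)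

namespace SlotNoise

variable {N : ℕ}

/-- The server decides to sample (this has an effect only if no external job is in service). -/
def sample (z : SlotNoise N) : Bool := z.1

/-- The user selected by the scheduling policy. -/
def user (z : SlotNoise N) : Fin N := z.2.1

/-- A machine that holds no external job switches between internally busy and free. -/
def switch (z : SlotNoise N) : Bool := z.2.2.1

/-- After completing an external job, the machine becomes internally busy (otherwise free). -/
def toBusy (z : SlotNoise N) : Bool := z.2.2.2.1

/-- A job of user `i` that is in service during the slot is completed at the end of the slot. -/
def done (z : SlotNoise N) (i : Fin N) : Bool := z.2.2.2.2 i

end SlotNoise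

/-- The Bernoulli distribution with success probability `p`. -/
noncomputable def bernoulliLaw (p : ℝ) : Measure Bool :=
  ENNReal.ofReal p • Measure.dirac true + ENNReal.ofReal (1 - p) • Measure.dirac false

/-- The distribution that gives mass `π i` to the user `i`. -/
noncomputable def schedulingLaw {N : ℕ} (π : Fin N → ℝ) : Measure (Fin N) :=
  ∑ i, ENNReal.ofReal (π i) • Measure.dirac i

/-- The joint law of the outcomes of one slot under the stationary randomized policy `(μ, π)`:
independent outcomes, sampling with probability `μ`, scheduling according to `π`, switching with
probability `q`, becoming internally busy upon a completion with probability `s`, completing a job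
of user `i` with probability `r i`. -/
noncomputable def slotLaw {N : ℕ} (μ : ℝ) (π : Fin N → ℝ) (q s : ℝ) (r : Fin N → ℝ) :
    Measure (SlotNoise N) :=
  (bernoulliLaw μ).prod ((schedulingLaw π).prod ((bernoulliLaw q).prod
    ((bernoulliLaw s).prod (Measure.pi fun i => bernoulliLaw (r i)))))

/-- `ξ t` are the outcomes of slot `t`; they are i.i.d. over the slots with law `slotLaw`. -/
structure IsSlotNoise {Ω : Type*} [MeasurableSpace Ω] (P : Measure Ω) {N : ℕ} (μ : ℝ)
    (π : Fin N → ℝ) (q s : ℝ) (r : Fin N → ℝ) (ξ : ℕ → Ω → SlotNoise N) : Prop where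
  measurable : ∀ t, Measurable (ξ t)
  indep : iIndepFun ξ P
  law : ∀ t, P.map (ξ t) = slotLaw μ π q s r

namespace SystemState

variable {N : ℕ}

/-- The state of the machine during the slot, after the server has acted: if the server samples a
free machine, it instantaneously assigns a job of the scheduled user, provided that there is one. -/
def assigned (x : SystemState N) (z : SlotNoise N) : MachineState N :=
  match x.machine with
  | .free => if z.sample = true ∧ 0 < x.queue z.user then .serving z.user else .free
  | .busy => .busy
  | .serving i => .serving i

/-- A job of user `i` is completed at the end of the slot. -/
def Completes (x : SystemState N) (z : SlotNoise N) (i : Fin N) : Prop :=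
  x.assigned z = .serving i ∧ z.done i = true

/-- The state of the machine at the beginning of the next slot. -/
def nextMachine (x : SystemState N) (z : SlotNoise N) : MachineState N :=
  match x.assigned z with
  | .busy => if z.switch then .free else .busy
  | .free => if z.switch then .busy else .free
  | .serving i => if z.done i then (if z.toBusy then .busy else .free) else .serving i

open Classical in
/-- The state of the system at the beginning of the next slot, where `a i` jobs of user `i` arrive
at the end of the present slot. Subtraction of natural numbers is truncated, so that the queues
follow `Q (t + 1) = max (Q t - b t, 0) + a t`. -/
noncomputable def next (x : SystemState N) (z : SlotNoise N) (a : Fin N → ℕ) : SystemState N where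
  machine := x.nextMachine z
  queue i := x.queue i - (if x.Completes z i then 1 else 0) + a i

end SystemState

/-- The state of the system at the beginning of slot `t`, for the slots `t = 1, 2, …`, given the
initial state `x₀`, the outcomes `z t` and the arrivals `a t` of all slots. (The value at `t = 0`
is not used.) -/
noncomputable def stateAt {N : ℕ} (x₀ : SystemState N) (z : ℕ → SlotNoise N)
    (a : ℕ → Fin N → ℕ) : ℕ → SystemState N
  | 0 => x₀
  | 1 => x₀
  | t + 2 => (stateAt x₀ z a (t + 1)).next (z (t + 1)) (a (t + 1))

/-- The completion event `b i t = 1` of user `i` in slot `t ≥ 1`. -/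
def CompletesAt {N : ℕ} (x₀ : SystemState N) (z : ℕ → SlotNoise N) (a : ℕ → Fin N → ℕ)
    (i : Fin N) (t : ℕ) : Prop :=
  1 ≤ t ∧ (stateAt x₀ z a t).Completes (z t) i

open Classical in
/-- The age of job completion of user `i` at time `t`: the time since the last completion of one of
its jobs before `t`. Before the first slot, the last completion was at time `-h i`. -/
noncomputable def age {N : ℕ} (x₀ : SystemState N) (h : Fin N → ℕ) (z : ℕ → SlotNoise N)
    (a : ℕ → Fin N → ℕ) (i : Fin N) (t : ℕ) : ℕ :=
  if ∃ t' < t, CompletesAt x₀ z a i t' then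
    t - sSup {t' : ℕ | t' < t ∧ CompletesAt x₀ z a i t'}
  else t + h i

/-- The average age of job completion of user `i`, the limit superior of the time averages of the
expected ages. -/
noncomputable def avgAge {Ω : Type*} [MeasurableSpace Ω] (P : Measure Ω) {N : ℕ}
    (x₀ : SystemState N) (h : Fin N → ℕ) (ξ : ℕ → Ω → SlotNoise N) (A : ℕ → Ω → Fin N → ℕ)
    (i : Fin N) : ℝ≥0∞ :=
  limsup (fun T : ℕ => (∑ t ∈ Finset.Icc 1 T,
    ∫⁻ ω, (age x₀ h (fun u => ξ u ω) (fun u => A u ω) i t : ℝ≥0∞) ∂P) / (T : ℝ≥0∞)) atTop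

/-- `η̄ = ∑ i ∈ S, π i / r i`. -/
noncomputable def etaBar {N : ℕ} (S : Finset (Fin N)) (π r : Fin N → ℝ) : ℝ :=
  ∑ i ∈ S, π i / r i

/-- `η k = η̄ - π k / r k`. -/
noncomputable def eta {N : ℕ} (S : Finset (Fin N)) (π r : Fin N → ℝ) (k : Fin N) : ℝ :=
  etaBar S π r - π k / r k

/-- `ψ k = η k + π k + 2 (1 / μ - 1) + s / q`. -/
noncomputable def psi {N : ℕ} (S : Finset (Fin N)) (μ : ℝ) (π : Fin N → ℝ) (q s : ℝ)
    (r : Fin N → ℝ) (k : Fin N) : ℝ :=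
  eta S π r k + π k + 2 * (1 / μ - 1) + s / q

/-! ### Integration against the law of the outcomes of one slot -/

/-! Almost surely every drawn user lies in `S` and so has a non-empty queue. The queues and arrivals
then drop out, and the pair (machine, age of `k`) is a Markov chain driven by the i.i.d. outcomes
(`chainAt_eq`).

Its average age comes from a Poisson equation: a function `g` of the pair with `E[g(next)] = g + D -
age`. Raising the present age by one raises every later age up to the next completion of `k`, so `g`
should be affine in the age with slope `meanTime`. Writing `g = meanTime * (age - 1) + u`, the slope
condition is the first-step equation of `meanTime`, and `u` must solve a Poisson equation of the
machine alone with right-hand side `D - meanTime`. Its solvability fixes `D`, which is the claimed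
value (`meanTimeFree_eq`, `meanAge_eq`, `integral_agePotential_chainStep`).

Summing the equation over time telescopes. The boundary terms are bounded by a drift argument, so
the averages of the expected age converge to `D` (`tendsto_average_of_drift`), without any appeal to
stationarity or renewal theory. -/

lemma isProbabilityMeasure_bernoulliLaw {p : ℝ} (h0 : 0 ≤ p) (h1 : p ≤ 1) :
    IsProbabilityMeasure (bernoulliLaw p) := by
  constructor
  simp only [bernoulliLaw, Measure.coe_add, Measure.coe_smul, Pi.add_apply, Pi.smul_apply,
    measure_univ, smul_eq_mul, mul_one]
  rw [← ENNReal.ofReal_add h0 (by linarith)]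
  simp

lemma integral_bernoulliLaw {p : ℝ} (h0 : 0 ≤ p) (h1 : p ≤ 1) (f : Bool → ℝ) :
    ∫ x, f x ∂(bernoulliLaw p) = p * f true + (1 - p) * f false := by
  rw [bernoulliLaw, integral_add_measure, integral_smul_measure, integral_smul_measure]
  · simp [ENNReal.toReal_ofReal, h0, h1]
  · exact (integrable_dirac (by simp)).smul_measure ENNReal.ofReal_ne_top
  · exact (integrable_dirac (by simp)).smul_measure ENNReal.ofReal_ne_top

lemma isProbabilityMeasure_schedulingLaw {N : ℕ} {π : Fin N → ℝ} (h0 : ∀ i, 0 ≤ π i)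
    (h1 : ∑ i, π i = 1) : IsProbabilityMeasure (schedulingLaw π) := by
  constructor
  simp only [schedulingLaw, Measure.coe_finsetSum, Measure.coe_smul, Finset.sum_apply,
    Pi.smul_apply, measure_univ, smul_eq_mul, mul_one]
  rw [← ENNReal.ofReal_sum_of_nonneg fun i _ => h0 i, h1, ENNReal.ofReal_one]

lemma integral_schedulingLaw {N : ℕ} {π : Fin N → ℝ} (h0 : ∀ i, 0 ≤ π i) (f : Fin N → ℝ) :
    ∫ i, f i ∂(schedulingLaw π) = ∑ i, π i * f i := by
  rw [schedulingLaw, integral_finsetSum_measure]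
  · simp [integral_smul_measure, ENNReal.toReal_ofReal, h0]
  · exact fun i _ => (integrable_dirac (by simp)).smul_measure ENNReal.ofReal_ne_top

lemma integral_pi_bernoulliLaw {N : ℕ} {r : Fin N → ℝ} (h0 : ∀ i, 0 ≤ r i) (h1 : ∀ i, r i ≤ 1)
    (i : Fin N) (f : Bool → ℝ) :
    ∫ d, f (d i) ∂(Measure.pi fun j => bernoulliLaw (r j)) = r i * f true + (1 - r i) * f false := by
  have := fun j => isProbabilityMeasure_bernoulliLaw (h0 j) (h1 j)
  have h := measurePreserving_eval (fun j => bernoulliLaw (r j)) i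
  rw [← integral_bernoulliLaw (h0 i) (h1 i), ← h.map_eq,
    integral_map h.measurable.aemeasurable (by fun_prop)]

lemma integral_slotLaw {N : ℕ} {μ q s : ℝ} {π r : Fin N → ℝ}
    (hμ : 0 ≤ μ) (hμ1 : μ ≤ 1) (hq : 0 ≤ q) (hq1 : q ≤ 1) (hs : 0 ≤ s) (hs1 : s ≤ 1)
    (hπ : ∀ i, 0 ≤ π i) (hπ1 : ∑ i, π i = 1) (hr : ∀ i, 0 ≤ r i) (hr1 : ∀ i, r i ≤ 1)
    (f : SlotNoise N → ℝ) :
    ∫ z, f z ∂(slotLaw μ π q s r) =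
      ∫ a, ∫ i, ∫ b, ∫ c, ∫ d, f (a, i, b, c, d) ∂(Measure.pi fun i => bernoulliLaw (r i))
        ∂(bernoulliLaw s) ∂(bernoulliLaw q) ∂(schedulingLaw π) ∂(bernoulliLaw μ) := by
  have := isProbabilityMeasure_bernoulliLaw hμ hμ1
  have := isProbabilityMeasure_bernoulliLaw hq hq1
  have := isProbabilityMeasure_bernoulliLaw hs hs1
  have := isProbabilityMeasure_schedulingLaw hπ hπ1
  have := fun i => isProbabilityMeasure_bernoulliLaw (hr i) (hr1 i)
  unfold slotLaw
  rw [integral_prod _ Integrable.of_finite]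
  congr 1; ext a
  rw [integral_prod _ Integrable.of_finite]
  congr 1; ext i
  rw [integral_prod _ Integrable.of_finite]
  congr 1; ext b
  rw [integral_prod _ Integrable.of_finite]

/-! ### The machine and the age as a Markov chain driven by the outcomes of the slots -/

open Classical in
/-- One step of the pair of the machine and the age of user `k` when no scheduled queue is empty. -/
noncomputable def chainStep {N : ℕ} (k : Fin N) (y : MachineState N × ℕ) (z : SlotNoise N) :
    MachineState N × ℕ :=
  ((⟨y.1, fun _ => 1⟩ : SystemState N).nextMachine z,
    if (⟨y.1, fun _ => 1⟩ : SystemState N).Completes z k then 1 else y.2 + 1)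

/-- The pair of the machine and the age of user `k` at time `n + 1`, when no scheduled queue is
empty. -/
noncomputable def chainAt {N : ℕ} (k : Fin N) (y₀ : MachineState N × ℕ) (z : ℕ → SlotNoise N) :
    ℕ → MachineState N × ℕ
  | 0 => y₀
  | n + 1 => chainStep k (chainAt k y₀ z n) (z (n + 1))

lemma chainAt_congr {N : ℕ} (k : Fin N) (y₀ : MachineState N × ℕ) {z z' : ℕ → SlotNoise N} (n : ℕ)
    (h : ∀ u ≤ n, z u = z' u) : chainAt k y₀ z n = chainAt k y₀ z' n := by
  induction n with
  | zero => rfl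
  | succ n ih => rw [chainAt, chainAt, ih fun u hu => h u (by omega), h _ le_rfl]

lemma age_zero {N : ℕ} (x₀ : SystemState N) (h : Fin N → ℕ) (z : ℕ → SlotNoise N)
    (a : ℕ → Fin N → ℕ) (k : Fin N) : age x₀ h z a k 0 = h k := by
  simp [age]

open Classical in
lemma age_succ {N : ℕ} (x₀ : SystemState N) (h : Fin N → ℕ) (z : ℕ → SlotNoise N)
    (a : ℕ → Fin N → ℕ) (k : Fin N) (t : ℕ) :
    age x₀ h z a k (t + 1) = if CompletesAt x₀ z a k t then 1 else age x₀ h z a k t + 1 := by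
  split_ifs with hc
  · have hg : IsGreatest {t' : ℕ | t' < t + 1 ∧ CompletesAt x₀ z a k t'} t :=
      ⟨⟨by omega, hc⟩, fun u hu => by have := hu.1; omega⟩
    rw [age, if_pos ⟨t, by omega, hc⟩, hg.csSup_eq]
    omega
  · have hiff : ∀ u, (u < t + 1 ∧ CompletesAt x₀ z a k u) ↔ (u < t ∧ CompletesAt x₀ z a k u) := by
      refine fun u => ⟨fun hu => ⟨?_, hu.2⟩, fun hu => ⟨by omega, hu.2⟩⟩
      have : u ≠ t := fun e => hc (e ▸ hu.2)
      omega
    simp only [age, hiff]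
    split_ifs with he
    · have hm := Nat.sSup_mem (s := {u | u < t ∧ CompletesAt x₀ z a k u}) he
        ⟨t, fun u hu => hu.1.le⟩
      have := hm.1
      omega
    · omega

lemma assigned_eq {N : ℕ} (x : SystemState N) (z : SlotNoise N) (hx : 0 < x.queue z.user) :
    x.assigned z = (⟨x.machine, fun _ => 1⟩ : SystemState N).assigned z := by
  simp [SystemState.assigned, hx]

lemma nextMachine_eq {N : ℕ} (x : SystemState N) (z : SlotNoise N) (hx : 0 < x.queue z.user) :
    x.nextMachine z = (⟨x.machine, fun _ => 1⟩ : SystemState N).nextMachine z := by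
  simp [SystemState.nextMachine, assigned_eq x z hx]

lemma completes_iff {N : ℕ} (x : SystemState N) (z : SlotNoise N) (hx : 0 < x.queue z.user)
    (k : Fin N) :
    x.Completes z k ↔ (⟨x.machine, fun _ => 1⟩ : SystemState N).Completes z k := by
  simp [SystemState.Completes, assigned_eq x z hx]

open Classical in
lemma chainAt_eq {N : ℕ} (x₀ : SystemState N) (h : Fin N → ℕ) (z : ℕ → SlotNoise N)
    (a : ℕ → Fin N → ℕ) (k : Fin N)
    (hz : ∀ t, 1 ≤ t → 0 < (stateAt x₀ z a t).queue (z t).user) (n : ℕ) :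
    chainAt k (x₀.machine, h k + 1) z n =
      ((stateAt x₀ z a (n + 1)).machine, age x₀ h z a k (n + 1)) := by
  induction n with
  | zero =>
    rw [age_succ, age_zero, if_neg (by simp [CompletesAt])]
    rfl
  | succ n ih =>
    have hn := hz (n + 1) (by omega)
    have hc := completes_iff _ _ hn k
    rw [chainAt, ih, chainStep, age_succ _ _ _ _ _ (n + 1), ← nextMachine_eq _ _ hn]
    exact Prod.ext rfl (if_congr (hc.symm.trans (by simp [CompletesAt])) rfl rfl)

/-! ### Averages along the chain -/

lemma integral_indepFun {Ω α β : Type*} [MeasurableSpace Ω] {P : Measure Ω}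
    [IsProbabilityMeasure P] [MeasurableSpace α] [MeasurableSpace β] [Finite α] [Finite β]
    [DiscreteMeasurableSpace α] [DiscreteMeasurableSpace β] {X : Ω → α} {Z : Ω → β}
    (hX : Measurable X) (hZ : Measurable Z) (h : IndepFun X Z P) (F : α → β → ℝ) :
    ∫ ω, F (X ω) (Z ω) ∂P = ∫ ω, ∫ z, F (X ω) z ∂(P.map Z) ∂P := by
  have := Measure.isProbabilityMeasure_map (μ := P) hX.aemeasurable
  have := Measure.isProbabilityMeasure_map (μ := P) hZ.aemeasurable
  have e := integral_map (μ := P) (hX.prodMk hZ).aemeasurable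
    (f := fun p : α × β => F p.1 p.2) (by fun_prop)
  rw [← e, (indepFun_iff_map_prod_eq_prod_map_map hX.aemeasurable hZ.aemeasurable).1 h,
    integral_prod _ Integrable.of_finite,
    integral_map hX.aemeasurable Measurable.of_discrete.aestronglyMeasurable]

/-- The chain up to a given time is a function of finitely many outcomes. -/
lemma exists_chainAt_eq {N : ℕ} (k : Fin N) (y₀ : MachineState N × ℕ) (n : ℕ) :
    ∃ G : (Finset.range (n + 1) → SlotNoise N) → MachineState N × ℕ,
      ∀ z : ℕ → SlotNoise N, chainAt k y₀ z n = G fun u => z u := by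
  -- Outcomes after time `n` are irrelevant, so any filler serves; the value of `p` at `0` is at
  -- hand.
  refine ⟨fun p => chainAt k y₀ (fun u => if h : u ∈ Finset.range (n + 1) then p ⟨u, h⟩
    else p ⟨0, by simp⟩) n, fun z => chainAt_congr k y₀ n fun u hu => ?_⟩
  rw [dif_pos (Finset.mem_range.2 (by omega))]

/-- At a fixed time the chain depends on finitely many outcomes with finitely many values, so no
growth condition on `f` is needed. -/
lemma integrable_chainAt {Ω : Type*} [MeasurableSpace Ω] {P : Measure Ω} [IsProbabilityMeasure P]
    {N : ℕ} {ξ : ℕ → Ω → SlotNoise N} (hξ : ∀ t, Measurable (ξ t)) (k : Fin N)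
    (y₀ : MachineState N × ℕ) (n : ℕ) (f : MachineState N × ℕ → ℝ) :
    Integrable (fun ω => f (chainAt k y₀ (fun u => ξ u ω) n)) P := by
  obtain ⟨G, hG⟩ := exists_chainAt_eq k y₀ n
  simp only [hG]
  have hX : Measurable fun ω (u : Finset.range (n + 1)) => ξ u ω :=
    measurable_pi_lambda _ fun u => hξ u
  have := Measure.isProbabilityMeasure_map (μ := P) hX.aemeasurable
  exact (Integrable.of_finite (μ := P.map _) (f := fun p => f (G p))).comp_measurable hX

/-- Markov property: the chain at index `n` uses outcomes up to `n` only, and these are independent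
of outcome `n + 1`. -/
lemma integral_chainAt_succ {Ω : Type*} [MeasurableSpace Ω] {P : Measure Ω}
    [IsProbabilityMeasure P] {N : ℕ} {ξ : ℕ → Ω → SlotNoise N} (hξ : ∀ t, Measurable (ξ t))
    (hi : iIndepFun ξ P) {ν : Measure (SlotNoise N)} (hν : ∀ t, P.map (ξ t) = ν) (k : Fin N)
    (y₀ : MachineState N × ℕ) (n : ℕ) (f : MachineState N × ℕ → ℝ) :
    ∫ ω, f (chainAt k y₀ (fun u => ξ u ω) (n + 1)) ∂P =
      ∫ ω, ∫ z, f (chainStep k (chainAt k y₀ (fun u => ξ u ω) n) z) ∂ν ∂P := by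
  obtain ⟨G, hG⟩ := exists_chainAt_eq k y₀ n
  simp only [chainAt, hG]
  have hX : Measurable fun ω (u : Finset.range (n + 1)) => ξ u ω :=
    measurable_pi_lambda _ fun u => hξ u
  have hind : IndepFun (fun ω (u : Finset.range (n + 1)) => ξ u ω) (ξ (n + 1)) P :=
    (hi.indepFun_finset (Finset.range (n + 1)) {n + 1} (by simp) hξ).comp
      (φ := id) (ψ := fun p : ({n + 1} : Finset ℕ) → SlotNoise N => p ⟨n + 1, by simp⟩)
      measurable_id (measurable_pi_apply _)
  rw [← hν (n + 1)]
  exact integral_indepFun hX (hξ _) hind fun p z => f (chainStep k (G p) z)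

/-- The recursion telescopes to `∑ v = T * D + x 0 - x T`, so it suffices that `x` is bounded. A
large `x n` forces a large `v n`, which pushes `x` back down. -/
lemma tendsto_average_of_drift {x v : ℕ → ℝ} {D A B : ℝ} (hA : 1 ≤ A)
    (hx : ∀ n, x (n + 1) = x n + D - v n) (hle : ∀ n, x n ≤ A * v n + B) (hge : ∀ n, -B ≤ x n) :
    Tendsto (fun T : ℕ => (∑ n ∈ Finset.range T, v n) / T) atTop (nhds D) := by
  have hup : ∀ n, x n ≤ max (x 0) (B + A * D) := by
    intro n
    induction n with
    | zero => exact le_max_left _ _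
    | succ n ih =>
      set C := max (x 0) (B + A * D)
      have hC : B + A * D ≤ C := le_max_right _ _
      have h1 := hle n
      have h2 := hx n
      -- This gives `A * x (n + 1) ≤ (A - 1) * x n + (B + A * D) ≤ (A - 1) * C + C`; the last step
      -- needs `1 ≤ A`.
      have h3 : 0 ≤ (A - 1) * (C - x n) := mul_nonneg (by linarith) (by linarith)
      have h4 : A * x (n + 1) = A * x n + A * D - A * v n := by rw [h2]; ring
      have : A * x (n + 1) ≤ A * C := by linarith
      exact le_of_mul_le_mul_left this (by linarith)
  have hsum : ∀ T : ℕ, ∑ n ∈ Finset.range T, v n = T * D + (x 0 - x T) := by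
    intro T
    induction T with
    | zero => simp
    | succ T ih => rw [Finset.sum_range_succ, ih, hx]; push_cast; ring
  have hb : Tendsto (fun T : ℕ => (x 0 - x T) / (T : ℝ)) atTop (nhds 0) := by
    refine tendsto_bdd_div_atTop_nhds_zero (b := x 0 - max (x 0) (B + A * D)) (B := x 0 + B)
      (Eventually.of_forall fun n => ?_) (Eventually.of_forall fun n => ?_)
      tendsto_natCast_atTop_atTop
    · linarith [hup n]
    · linarith [hge n]
  have := hb.const_add D
  rw [add_zero] at this
  refine this.congr' ?_
  filter_upwards [eventually_gt_atTop 0] with T hT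
  have : (T : ℝ) ≠ 0 := by positivity
  rw [hsum]
  field_simp

lemma slotLaw_user_notMem {N : ℕ} {μ q s : ℝ} {π r : Fin N → ℝ} {S : Finset (Fin N)}
    (hr : ∀ i, 0 ≤ r i) (hr1 : ∀ i, r i ≤ 1) (hq : 0 ≤ q) (hq1 : q ≤ 1) (hs : 0 ≤ s) (hs1 : s ≤ 1)
    (hπ0 : ∀ i ∉ S, π i = 0) (hπ : ∀ i, 0 ≤ π i) (hπ1 : ∑ i, π i = 1) :
    slotLaw μ π q s r {z | z.user ∉ S} = 0 := by
  have := isProbabilityMeasure_bernoulliLaw hq hq1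
  have := isProbabilityMeasure_bernoulliLaw hs hs1
  have := isProbabilityMeasure_schedulingLaw hπ hπ1
  have := fun i => isProbabilityMeasure_bernoulliLaw (hr i) (hr1 i)
  have e : {z : SlotNoise N | z.user ∉ S} =
      Set.univ ×ˢ ((S : Set (Fin N))ᶜ ×ˢ Set.univ) := by
    ext z; simp [SlotNoise.user]
  have h0 : schedulingLaw π (S : Set (Fin N))ᶜ = 0 := by
    simp only [schedulingLaw, Measure.coe_finsetSum, Measure.coe_smul, Finset.sum_apply,
      Pi.smul_apply, smul_eq_mul]
    refine Finset.sum_eq_zero fun i _ => ?_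
    by_cases hi : i ∈ S
    · simp [hi]
    · simp [hπ0 i hi]
  rw [e, slotLaw, Measure.prod_prod, Measure.prod_prod, h0]
  simp

/-! ### One-step transitions and expectations of the chain -/

/-- The value of `f` after a slot in which a job of user `i` is in process, if `c` tells whether the
machine would become busy and `d` whether the job is completed. -/
def servedValue {N : ℕ} (f : MachineState N × ℕ → ℝ) (k : Fin N) (v : ℕ) (i : Fin N) (c d : Bool) :
    ℝ :=
  if d then f (if c then .busy else .free, if i = k then 1 else v + 1) else f (.serving i, v + 1)

lemma chainStep_busy {N : ℕ} (k : Fin N) (v : ℕ) (z : SlotNoise N) :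
    chainStep k (.busy, v) z = (if z.switch then .free else .busy, v + 1) := by
  simp [chainStep, SystemState.nextMachine, SystemState.assigned, SystemState.Completes]

lemma apply_chainStep_serving {N : ℕ} (f : MachineState N × ℕ → ℝ) (k : Fin N) (v : ℕ)
    (i : Fin N) (z : SlotNoise N) :
    f (chainStep k (.serving i, v) z) = servedValue f k v i z.toBusy (z.done i) := by
  rcases eq_or_ne i k with rfl | hik
  · cases h : z.done i <;>
    simp [chainStep, SystemState.nextMachine, SystemState.assigned, SystemState.Completes,
      servedValue, h]
  · cases h : z.done i <;>
    simp [chainStep, SystemState.nextMachine, SystemState.assigned, SystemState.Completes,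
      servedValue, h, hik]

lemma apply_chainStep_free {N : ℕ} (f : MachineState N × ℕ → ℝ) (k : Fin N) (v : ℕ)
    (z : SlotNoise N) :
    f (chainStep k (.free, v) z) =
      if z.sample then servedValue f k v z.user z.toBusy (z.done z.user)
      else f (if z.switch then .busy else .free, v + 1) := by
  cases h : z.sample
  · simp [chainStep, SystemState.nextMachine, SystemState.assigned, SystemState.Completes, h]
  -- Assignment is instantaneous, so a sampled free machine behaves in this slot as one already
  -- serving the drawn user.
  · rw [← apply_chainStep_serving]
    simp [chainStep, SystemState.nextMachine, SystemState.assigned, SystemState.Completes, h]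

section OneStep

variable {N : ℕ} {μ q s : ℝ} {π r : Fin N → ℝ}

lemma integral_chainStep_busy (hμ : 0 ≤ μ) (hμ1 : μ ≤ 1) (hq : 0 ≤ q) (hq1 : q ≤ 1)
    (hs : 0 ≤ s) (hs1 : s ≤ 1) (hπ : ∀ i, 0 ≤ π i) (hπ1 : ∑ i, π i = 1) (hr : ∀ i, 0 ≤ r i)
    (hr1 : ∀ i, r i ≤ 1) (f : MachineState N × ℕ → ℝ) (k : Fin N) (v : ℕ) :
    ∫ z, f (chainStep k (.busy, v) z) ∂(slotLaw μ π q s r) =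
      q * f (.free, v + 1) + (1 - q) * f (.busy, v + 1) := by
  have := isProbabilityMeasure_bernoulliLaw hs hs1
  have := fun i => isProbabilityMeasure_bernoulliLaw (hr i) (hr1 i)
  rw [integral_slotLaw hμ hμ1 hq hq1 hs hs1 hπ hπ1 hr hr1]
  simp only [chainStep_busy, SlotNoise.switch, integral_bernoulliLaw hμ hμ1,
    integral_bernoulliLaw hq hq1, integral_schedulingLaw hπ, integral_const, probReal_univ,
    one_smul, ← Finset.sum_mul, hπ1, if_true, Bool.false_eq_true, if_false]
  ring

lemma integral_servedValue (hs : 0 ≤ s) (hs1 : s ≤ 1) (hr : ∀ i, 0 ≤ r i) (hr1 : ∀ i, r i ≤ 1)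
    (f : MachineState N × ℕ → ℝ) (k : Fin N) (v : ℕ) (i : Fin N) :
    ∫ c, ∫ d, servedValue f k v i c (d i) ∂(Measure.pi fun j => bernoulliLaw (r j))
        ∂(bernoulliLaw s) =
      r i * (s * f (.busy, if i = k then 1 else v + 1) +
        (1 - s) * f (.free, if i = k then 1 else v + 1)) + (1 - r i) * f (.serving i, v + 1) := by
  have e (c : Bool) := integral_pi_bernoulliLaw hr hr1 i (servedValue f k v i c)
  simp only [e, integral_bernoulliLaw hs hs1]
  simp only [servedValue, if_true, Bool.false_eq_true, if_false]
  ring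

lemma integral_chainStep_serving (hμ : 0 ≤ μ) (hμ1 : μ ≤ 1) (hq : 0 ≤ q) (hq1 : q ≤ 1)
    (hs : 0 ≤ s) (hs1 : s ≤ 1) (hπ : ∀ i, 0 ≤ π i) (hπ1 : ∑ i, π i = 1) (hr : ∀ i, 0 ≤ r i)
    (hr1 : ∀ i, r i ≤ 1) (f : MachineState N × ℕ → ℝ) (k : Fin N) (v : ℕ) (i : Fin N) :
    ∫ z, f (chainStep k (.serving i, v) z) ∂(slotLaw μ π q s r) =
      r i * (s * f (.busy, if i = k then 1 else v + 1) +
        (1 - s) * f (.free, if i = k then 1 else v + 1)) + (1 - r i) * f (.serving i, v + 1) := by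
  rw [integral_slotLaw hμ hμ1 hq hq1 hs hs1 hπ hπ1 hr hr1]
  simp only [apply_chainStep_serving, SlotNoise.toBusy, SlotNoise.done,
    integral_servedValue hs hs1 hr hr1]
  simp only [integral_bernoulliLaw hμ hμ1, integral_bernoulliLaw hq hq1,
    integral_schedulingLaw hπ, ← Finset.sum_mul, hπ1]
  ring

lemma integral_chainStep_free (hμ : 0 ≤ μ) (hμ1 : μ ≤ 1) (hq : 0 ≤ q) (hq1 : q ≤ 1)
    (hs : 0 ≤ s) (hs1 : s ≤ 1) (hπ : ∀ i, 0 ≤ π i) (hπ1 : ∑ i, π i = 1) (hr : ∀ i, 0 ≤ r i)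
    (hr1 : ∀ i, r i ≤ 1) (f : MachineState N × ℕ → ℝ) (k : Fin N) (v : ℕ) :
    ∫ z, f (chainStep k (.free, v) z) ∂(slotLaw μ π q s r) =
      μ * ∑ i, π i * (r i * (s * f (.busy, if i = k then 1 else v + 1) +
        (1 - s) * f (.free, if i = k then 1 else v + 1)) + (1 - r i) * f (.serving i, v + 1)) +
      (1 - μ) * (q * f (.busy, v + 1) + (1 - q) * f (.free, v + 1)) := by
  have := isProbabilityMeasure_bernoulliLaw hs hs1
  have := fun i => isProbabilityMeasure_bernoulliLaw (hr i) (hr1 i)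
  rw [integral_slotLaw hμ hμ1 hq hq1 hs hs1 hπ hπ1 hr hr1]
  simp only [apply_chainStep_free, SlotNoise.toBusy, SlotNoise.done, SlotNoise.sample,
    SlotNoise.user, SlotNoise.switch, integral_bernoulliLaw hμ hμ1, if_true, Bool.false_eq_true,
    if_false, integral_servedValue hs hs1 hr hr1]
  simp only [integral_bernoulliLaw hq hq1,
    integral_schedulingLaw hπ, integral_const, probReal_univ,
    one_smul, ← Finset.sum_mul, hπ1, if_true, Bool.false_eq_true, if_false]
  congr 1
  · congr 1
    exact Finset.sum_congr rfl fun i _ => by ring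
  · ring

end OneStep

/-! ### The Poisson equation of the age -/

/-- The mean time to the next completion of a job of user `k`, if it is `w` for a free machine. -/
noncomputable def meanTime {N : ℕ} (q s : ℝ) (r : Fin N → ℝ) (k : Fin N) (w : ℝ) :
    MachineState N → ℝ
  | .busy => w + 1 / q
  | .free => w
  | .serving i => if i = k then 1 / r i else 1 / r i + w + s / q

/-- The solution, normalized to vanish for a free machine, of the Poisson equation of the machine
with right-hand side `D - meanTime`. -/
noncomputable def meanTimePotential {N : ℕ} (q s : ℝ) (r : Fin N → ℝ) (k : Fin N) (w D : ℝ) :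
    MachineState N → ℝ
  | .busy => (w + 1 / q - D) / q
  | .free => 0
  | .serving i => s * ((w + 1 / q - D) / q) + (meanTime q s r k w (.serving i) - D) / r i

/-- The solution of the Poisson equation of the age with right-hand side `D - age`. -/
noncomputable def agePotential {N : ℕ} (q s : ℝ) (r : Fin N → ℝ) (k : Fin N) (w D : ℝ)
    (y : MachineState N × ℕ) : ℝ :=
  meanTime q s r k w y.1 * y.2 + (meanTimePotential q s r k w D y.1 - meanTime q s r k w y.1)

/-- A completion by `k` resets the age to `1`, where the term `meanTime * (age - 1)` vanishes and
only `meanTimePotential` remains; this is why `agePotential` subtracts `meanTime`. -/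
lemma agePotential_serving_step {N : ℕ} {q s : ℝ} {r : Fin N → ℝ} (hq : 0 < q)
    (hr : ∀ i, 0 < r i) (k : Fin N) (w D : ℝ) (i : Fin N) (v : ℕ) :
    r i * (s * agePotential q s r k w D (.busy, if i = k then 1 else v + 1) +
        (1 - s) * agePotential q s r k w D (.free, if i = k then 1 else v + 1)) +
      (1 - r i) * agePotential q s r k w D (.serving i, v + 1) =
    agePotential q s r k w D (.serving i, v) + D - v := by
  have := hr i
  simp only [agePotential, meanTimePotential, meanTime]
  split_ifs
  · push_cast
    field_simp
    ring
  · push_cast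
    field_simp
    ring

/-- For a busy or serving machine the equation holds for every `w` and `D`. Only the free state
imposes conditions: `hw` is the coefficient of the age, `hD` the constant term. -/
lemma integral_agePotential_chainStep {N : ℕ} {μ q s : ℝ} {π r : Fin N → ℝ} (hμ : 0 ≤ μ) (hμ1 : μ ≤ 1) (hq : 0 < q) (hq1 : q ≤ 1)
    (hs : 0 ≤ s) (hs1 : s ≤ 1) (hπ : ∀ i, 0 ≤ π i) (hπ1 : ∑ i, π i = 1) (hr : ∀ i, 0 < r i)
    (hr1 : ∀ i, r i ≤ 1) (k : Fin N)
    {w D : ℝ} (hw : μ * ∑ i, π i * meanTime q s r k w (.serving i) + (1 - μ) * (2 + w) = w)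
    (hD : μ * ∑ i, π i * (meanTimePotential q s r k w D (.serving i) + D -
      meanTime q s r k w (.serving i)) + (1 - μ) * (w + 1 / q - D) = D - w)
    (y : MachineState N × ℕ) :
    ∫ z, agePotential q s r k w D (chainStep k y z) ∂(slotLaw μ π q s r) =
      agePotential q s r k w D y + D - y.2 := by
  have hr' := fun i => (hr i).le
  obtain ⟨m, v⟩ := y
  cases m with
  | busy =>
    rw [integral_chainStep_busy hμ hμ1 hq.le hq1 hs hs1 hπ hπ1 hr' hr1]
    simp only [agePotential, meanTimePotential, meanTime]
    push_cast
    field_simp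
    ring
  | serving i =>
    rw [integral_chainStep_serving hμ hμ1 hq.le hq1 hs hs1 hπ hπ1 hr' hr1,
      agePotential_serving_step hq hr]
  | free =>
    rw [integral_chainStep_free hμ hμ1 hq.le hq1 hs hs1 hπ hπ1 hr' hr1]
    simp only [agePotential_serving_step hq hr]
    have e : ∑ i, π i * (agePotential q s r k w D (.serving i, v) + D - v) =
        (∑ i, π i * meanTime q s r k w (.serving i)) * v +
        ∑ i, π i * (meanTimePotential q s r k w D (.serving i) + D -
          meanTime q s r k w (.serving i)) - (∑ i, π i) * v := by
      simp only [Finset.sum_mul, ← Finset.sum_add_distrib, ← Finset.sum_sub_distrib, agePotential]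
      exact Finset.sum_congr rfl fun i _ => by ring
    rw [e, hπ1]
    have eB : q * agePotential q s r k w D (.busy, v + 1) +
        (1 - q) * agePotential q s r k w D (.free, v + 1) =
        (2 + w) * v + (w + 1 / q - D) - v := by
      simp only [agePotential, meanTimePotential, meanTime]
      push_cast
      field_simp
      ring
    rw [eB]
    simp only [agePotential, meanTimePotential, meanTime] at hw hD ⊢
    linear_combination (v : ℝ) * hw + hD

/-! ### Closed forms for the two constants -/

/-- The mean time from a free machine to the next completion of a job of user `k`. -/
noncomputable def meanTimeFree {N : ℕ} (S : Finset (Fin N)) (μ : ℝ) (π : Fin N → ℝ) (q s : ℝ)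
    (r : Fin N → ℝ) (k : Fin N) : ℝ :=
  (2 * (1 / μ - 1) + etaBar S π r + (1 - π k) * (s / q)) / π k

/-- The value of the average age of user `k`. -/
noncomputable def meanAge {N : ℕ} (S : Finset (Fin N)) (μ : ℝ) (π : Fin N → ℝ) (q s : ℝ)
    (r : Fin N → ℝ) (k : Fin N) : ℝ :=
  1 / (s / q + 2 * (1 / μ - 1) + etaBar S π r) *
          (psi S μ π q s r k ^ 2 / π k
            + (1 / r k + (1 - s) / q - 2) * psi S μ π q s r k
            + 1 / q * ((1 - s) * (1 - π k - eta S π r k) - 1 / μ)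
            - π k * (1 - r k) / r k
            + ∑ i ∈ S, π i * (1 - r i) / r i ^ 2) + 1

/-- The weight `g = 1` serves the equation for `w`, and `g i = 1 / r i - 1` the one for `D`. The
term of `k` is removed because no return to a free machine follows its completion. -/
lemma sum_mul_meanTime {N : ℕ} {q s : ℝ} {π r : Fin N → ℝ} {S : Finset (Fin N)} {k : Fin N}
    (hπ0 : ∀ i ∉ S, π i = 0) (g : Fin N → ℝ) (w : ℝ) :
    ∑ i, π i * (g i * meanTime q s r k w (.serving i)) =
      ∑ i ∈ S, π i * g i / r i + (∑ i ∈ S, π i * g i - π k * g k) * (w + s / q) := by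
  have e : ∀ i, π i * (g i * meanTime q s r k w (.serving i)) =
      π i * g i / r i + π i * g i * (w + s / q) -
        if i = k then π i * g i * (w + s / q) else 0 := by
    intro i
    simp only [meanTime]
    split_ifs <;> ring
  have hS : ∀ X : Fin N → ℝ, (∀ i, π i = 0 → X i = 0) → ∑ i ∈ S, X i = ∑ i, X i := fun X hX =>
    Finset.sum_subset (Finset.subset_univ S) fun i _ hi => hX i (hπ0 i hi)
  rw [Finset.sum_congr rfl fun i _ => e i, Finset.sum_sub_distrib, Finset.sum_add_distrib,
    Finset.sum_ite_eq' Finset.univ k, hS _ fun i hi => by simp [hi], hS _ fun i hi => by simp [hi],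
    ← Finset.sum_mul]
  simp
  ring

/-- First-step equation at a free machine. An unsampled slot costs `1` and, with probability `q`, a
busy period of mean `1 / q`: together `2`, whatever `q` is. -/
lemma meanTimeFree_eq {N : ℕ} {μ q s : ℝ} {π r : Fin N → ℝ} {S : Finset (Fin N)} {k : Fin N}
    (hμ : 0 < μ) (hq : 0 < q) (hk : 0 < π k) (hπ0 : ∀ i ∉ S, π i = 0) (hπ1 : ∑ i ∈ S, π i = 1) :
    μ * ∑ i, π i * meanTime q s r k (meanTimeFree S μ π q s r k) (.serving i) +
      (1 - μ) * (2 + meanTimeFree S μ π q s r k) = meanTimeFree S μ π q s r k := by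
  have e := sum_mul_meanTime (q := q) (s := s) (r := r) (k := k) hπ0 (fun _ => 1)
    (meanTimeFree S μ π q s r k)
  simp only [mul_one, one_mul, hπ1] at e
  rw [e, ← etaBar, meanTimeFree]
  field_simp
  ring

/-- Pure algebra: the sum `∑ π i * (1 - r i) / r i ^ 2` enters only as an opaque `W`. -/
lemma poissonConstant_eq {N : ℕ} {μ q s D W : ℝ} {π r : Fin N → ℝ} {S : Finset (Fin N)}
    {k : Fin N} (hμ : 0 < μ) (hq : 0 < q) (hr : 0 < r k) (hπ : 0 < π k)
    (hD : (D - 1) * (s / q + 2 * (1 / μ - 1) + etaBar S π r) =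
      psi S μ π q s r k ^ 2 / π k + (1 / r k + (1 - s) / q - 2) * psi S μ π q s r k
        + 1 / q * ((1 - s) * (1 - π k - eta S π r k) - 1 / μ) - π k * (1 - r k) / r k + W) :
    μ * (W + (etaBar S π r - 1 - π k * (1 / r k - 1)) * (meanTimeFree S μ π q s r k + s / q) +
        (s * ((meanTimeFree S μ π q s r k + 1 / q - D) / q) + D) * 1 - D * etaBar S π r) +
      (1 - μ) * (meanTimeFree S μ π q s r k + 1 / q - D) = D - meanTimeFree S μ π q s r k := by
  rw [psi, eta] at hD
  rw [meanTimeFree]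
  generalize etaBar S π r = η at *
  generalize π k = p at *
  generalize r k = ρ at *
  rw [← sub_eq_zero] at hD ⊢
  -- The difference of the two sides of the goal is `-μ` times that of `hD`.
  have e : ∀ x y : ℝ, x = -μ * y → y = 0 → x = 0 := fun x y h1 h2 => by rw [h1, h2, mul_zero]
  refine e _ _ ?_ hD
  field_simp
  ring

lemma meanAge_eq {N : ℕ} {μ q s : ℝ} {π r : Fin N → ℝ} {S : Finset (Fin N)} {k : Fin N}
    (hμ : 0 < μ) (hμ1 : μ ≤ 1) (hq : 0 < q) (hs : 0 ≤ s) (hr : ∀ i, 0 < r i)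
    (hπ : ∀ i ∈ S, 0 < π i) (hk : k ∈ S) (hπ0 : ∀ i ∉ S, π i = 0) (hπ1 : ∑ i ∈ S, π i = 1) :
    μ * ∑ i, π i * (meanTimePotential q s r k (meanTimeFree S μ π q s r k)
        (meanAge S μ π q s r k) (.serving i) + meanAge S μ π q s r k -
        meanTime q s r k (meanTimeFree S μ π q s r k) (.serving i)) +
      (1 - μ) * (meanTimeFree S μ π q s r k + 1 / q - meanAge S μ π q s r k) =
    meanAge S μ π q s r k - meanTimeFree S μ π q s r k := by
  set w := meanTimeFree S μ π q s r k with hw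
  set D := meanAge S μ π q s r k with hD
  have hπk := hπ k hk
  have hrk := hr k
  have hη : 0 < etaBar S π r :=
    Finset.sum_pos (fun i hi => div_pos (hπ i hi) (hr i)) ⟨k, hk⟩
  have hμ' : 0 ≤ 1 / μ - 1 := by
    rw [sub_nonneg, le_div_iff₀ hμ]; linarith
  -- This is the mean time between consecutive completions of any users; it is the coefficient that
  -- `D` is solved from.
  have hden : 0 < s / q + 2 * (1 / μ - 1) + etaBar S π r := by positivity
  have hS : ∀ X : Fin N → ℝ, (∀ i, π i = 0 → X i = 0) → ∑ i ∈ S, X i = ∑ i, X i := fun X hX =>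
    Finset.sum_subset (Finset.subset_univ S) fun i _ hi => hX i (hπ0 i hi)
  have e := sum_mul_meanTime (q := q) (s := s) (r := r) (k := k) hπ0 (fun i => 1 / r i - 1) w
  have e1 : ∑ i ∈ S, π i * (1 / r i - 1) = etaBar S π r - 1 := by
    calc _ = ∑ i ∈ S, π i / r i - ∑ i ∈ S, π i := by
          rw [← Finset.sum_sub_distrib]
          exact Finset.sum_congr rfl fun i _ => by ring
      _ = _ := by rw [hπ1, etaBar]
  have e2 : ∑ i ∈ S, π i * (1 / r i - 1) / r i = ∑ i ∈ S, π i * (1 - r i) / r i ^ 2 :=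
    Finset.sum_congr rfl fun i _ => by have := hr i; field_simp
  set W := ∑ i ∈ S, π i * (1 - r i) / r i ^ 2 with hW
  have e3 : ∑ i, π i * (meanTimePotential q s r k w D (.serving i) + D -
        meanTime q s r k w (.serving i)) =
      ∑ i, π i * ((1 / r i - 1) * meanTime q s r k w (.serving i)) +
        (s * ((w + 1 / q - D) / q) + D) * ∑ i, π i - D * ∑ i, π i / r i := by
    simp only [Finset.mul_sum, ← Finset.sum_add_distrib, ← Finset.sum_sub_distrib]
    refine Finset.sum_congr rfl fun i _ => ?_
    simp only [meanTimePotential]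
    ring
  rw [e3, e, e1, e2, ← hS _ fun i hi => hi, ← hS _ fun i hi => by simp [hi], hπ1, ← etaBar]
  have hDeq : (D - 1) * (s / q + 2 * (1 / μ - 1) + etaBar S π r) =
      psi S μ π q s r k ^ 2 / π k
            + (1 / r k + (1 - s) / q - 2) * psi S μ π q s r k
            + 1 / q * ((1 - s) * (1 - π k - eta S π r k) - 1 / μ)
            - π k * (1 - r k) / r k + W := by
    rw [hD, meanAge, add_sub_cancel_right, mul_right_comm, one_div_mul_cancel hden.ne', one_mul]
  exact poissonConstant_eq hμ hq hrk hπk hDeq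

/-! ### Convergence of the averages and conclusion -/

lemma exists_meanTime_le_and_potential_le {N : ℕ} (q s : ℝ) (r : Fin N → ℝ) (k : Fin N) (w D : ℝ) :
    ∃ A B : ℝ, 1 ≤ A ∧ (∀ m, meanTime q s r k w m ≤ A) ∧
      ∀ m, |meanTimePotential q s r k w D m - meanTime q s r k w m| ≤ B := by
  have key (g : MachineState N → ℝ) : ∃ C : ℝ, 0 ≤ C ∧ ∀ m, g m ≤ C := by
    refine ⟨|g .busy| + |g .free| + ∑ i, |g (.serving i)|, by positivity, fun m => ?_⟩
    have hsum : 0 ≤ ∑ i, |g (.serving i)| := by positivity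
    cases m with
    | busy => linarith [le_abs_self (g .busy), abs_nonneg (g .free)]
    | free => linarith [le_abs_self (g .free), abs_nonneg (g .busy)]
    | serving i =>
      have := Finset.single_le_sum (f := fun i => |g (.serving i)|) (fun i _ => abs_nonneg _)
        (Finset.mem_univ i)
      linarith [le_abs_self (g (.serving i)), abs_nonneg (g .busy), abs_nonneg (g .free)]
  obtain ⟨A, hA, hA'⟩ := key (meanTime q s r k w)
  obtain ⟨B, -, hB⟩ := key fun m => |meanTimePotential q s r k w D m - meanTime q s r k w m|
  -- The added `1` secures `1 ≤ A`, as the drift argument requires.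
  exact ⟨A + 1, B, by linarith, fun m => by linarith [hA' m], hB⟩

/-- The drift argument is applied to `x n = E[agePotential]` and `v n = E[age]`. The slope
`meanTime` lies between `0` and `A`, which gives the lower and the upper bound on `x n`. -/
lemma tendsto_average_integral_age {Ω : Type*} [MeasurableSpace Ω] {P : Measure Ω}
    [IsProbabilityMeasure P] {N : ℕ} {S : Finset (Fin N)} {q s : ℝ} {r : Fin N → ℝ} (hq : 0 < q)
    (hq1 : q ≤ 1) (hs : 0 ≤ s) (hs1 : s ≤ 1) (hr : ∀ i, 0 < r i) (hr1 : ∀ i, r i ≤ 1)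
    {μ : ℝ} {π : Fin N → ℝ} (hμ : 0 < μ) (hμ1 : μ ≤ 1) (hπ : ∀ i ∈ S, 0 < π i)
    (hπ0 : ∀ i ∉ S, π i = 0) (hπ1 : ∑ i ∈ S, π i = 1) {ξ : ℕ → Ω → SlotNoise N}
    (hξ : IsSlotNoise P μ π q s r ξ) {k : Fin N} (hk : k ∈ S) (y₀ : MachineState N × ℕ) :
    Tendsto (fun T : ℕ => (∑ n ∈ Finset.range T,
      ∫ ω, ((chainAt k y₀ (fun u => ξ u ω) n).2 : ℝ) ∂P) / T) atTop
      (nhds (meanAge S μ π q s r k)) := by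
  have hπn : ∀ i, 0 ≤ π i := fun i => by
    by_cases hi : i ∈ S
    exacts [(hπ i hi).le, (hπ0 i hi).ge]
  have hπ1' : ∑ i, π i = 1 := by
    rw [← hπ1]
    exact (Finset.sum_subset (Finset.subset_univ S) fun i _ hi => hπ0 i hi).symm
  set w := meanTimeFree S μ π q s r k with hw
  set D := meanAge S μ π q s r k with hD
  have hw0 : 0 ≤ w := by
    have h1 : π k ≤ 1 := hπ1 ▸ Finset.single_le_sum (fun i hi => (hπ i hi).le) hk
    have h2 : 0 ≤ etaBar S π r := Finset.sum_nonneg fun i _ => div_nonneg (hπn i) (hr i).le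
    have h3 : 0 ≤ 1 / μ - 1 := by rw [sub_nonneg, le_div_iff₀ hμ]; linarith
    have h4 : 0 ≤ 1 - π k := by linarith
    have := hπ k hk
    rw [hw, meanTimeFree]
    positivity
  have hm0 : ∀ m, 0 ≤ meanTime q s r k w m := by
    intro m
    cases m with
    | busy => simp only [meanTime]; positivity
    | free => exact hw0
    | serving i =>
      have := hr i
      simp only [meanTime]
      split_ifs <;> positivity
  obtain ⟨A, B, hA, hA', hB⟩ := exists_meanTime_le_and_potential_le q s r k w D
  have hint := integrable_chainAt (P := P) hξ.measurable k y₀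
  refine tendsto_average_of_drift
    (x := fun n => ∫ ω, agePotential q s r k w D (chainAt k y₀ (fun u => ξ u ω) n) ∂P)
    (A := A) (B := B) hA (fun n => ?_) (fun n => ?_) (fun n => ?_)
  · rw [integral_chainAt_succ hξ.measurable hξ.indep hξ.law k y₀ n (agePotential q s r k w D)]
    simp only [integral_agePotential_chainStep hμ.le hμ1 hq hq1 hs hs1 hπn hπ1' hr hr1 k
      (w := w) (D := D) (meanTimeFree_eq hμ hq (hπ k hk) hπ0 hπ1)
      (meanAge_eq hμ hμ1 hq hs hr hπ hk hπ0 hπ1)]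
    rw [integral_sub (hint n fun y => agePotential q s r k w D y + D) (hint n fun y => (y.2 : ℝ)),
      integral_add (hint n (agePotential q s r k w D)) (integrable_const _)]
    simp
  · have : ∫ ω, (A * ((chainAt k y₀ (fun u => ξ u ω) n).2 : ℝ) + B) ∂P =
        A * ∫ ω, ((chainAt k y₀ (fun u => ξ u ω) n).2 : ℝ) ∂P + B := by
      rw [integral_add (hint n fun y => A * (y.2 : ℝ)) (integrable_const _), integral_const_mul]
      simp
    rw [← this]
    refine integral_mono (hint n _) (hint n fun y => A * (y.2 : ℝ) + B) fun ω => ?_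
    exact add_le_add (mul_le_mul_of_nonneg_right (hA' _) (Nat.cast_nonneg _))
      (le_of_abs_le (hB _))
  · have : ∫ _, -B ∂P = -B := by simp
    rw [← this]
    refine integral_mono (integrable_const _) (hint n _) fun ω => ?_
    simp only [agePotential]
    have h1 := neg_le_of_abs_le (hB (chainAt k y₀ (fun u => ξ u ω) n).1)
    have h2 := mul_nonneg (hm0 (chainAt k y₀ (fun u => ξ u ω) n).1)
      (Nat.cast_nonneg (α := ℝ) (chainAt k y₀ (fun u => ξ u ω) n).2)
    linarith

theorem theorem1 {Ω : Type*} [MeasurableSpace Ω] (P : Measure Ω) [IsProbabilityMeasure P]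
    {N : ℕ} (S : Finset (Fin N)) (hS : S.Nonempty)
    -- machine parameters and service rates
    (q s : ℝ) (r : Fin N → ℝ) (hq : 0 < q) (hq1 : q ≤ 1) (hs : 0 < s) (hs1 : s ≤ 1)
    (hr : ∀ i, 0 < r i) (hr1 : ∀ i, r i ≤ 1)
    -- the stationary randomized policy on `S`
    (μ : ℝ) (π : Fin N → ℝ) (hμ : 0 < μ) (hμ1 : μ ≤ 1)
    (hπ : ∀ i ∈ S, 0 < π i) (hπ0 : ∀ i ∉ S, π i = 0) (hπ1 : ∑ i ∈ S, π i = 1)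
    -- initial state, initial ages, random outcomes and arrivals
    (x₀ : SystemState N) (h : Fin N → ℕ) (ξ : ℕ → Ω → SlotNoise N) (A : ℕ → Ω → Fin N → ℕ)
    (hξ : IsSlotNoise P μ π q s r ξ)
    -- the queues of the users in `S` are never empty
    (hQ : ∀ᵐ ω ∂P, ∀ t, 1 ≤ t → ∀ i ∈ S,
      0 < (stateAt x₀ (fun u => ξ u ω) (fun u => A u ω) t).queue i)
    (k : Fin N) (hk : k ∈ S) :
    ((avgAge P x₀ h ξ A k : ℝ≥0∞) : EReal) =
      ((1 / (s / q + 2 * (1 / μ - 1) + etaBar S π r) *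
          (psi S μ π q s r k ^ 2 / π k
            + (1 / r k + (1 - s) / q - 2) * psi S μ π q s r k
            + 1 / q * ((1 - s) * (1 - π k - eta S π r k) - 1 / μ)
            - π k * (1 - r k) / r k
            + ∑ i ∈ S, π i * (1 - r i) / r i ^ 2) + 1 : ℝ) : EReal) := by
  have hπn : ∀ i, 0 ≤ π i := fun i => by
    by_cases hi : i ∈ S
    exacts [(hπ i hi).le, (hπ0 i hi).ge]
  have hπ1' : ∑ i, π i = 1 := by
    rw [← hπ1]
    exact (Finset.sum_subset (Finset.subset_univ S) fun i _ hi => hπ0 i hi).symm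
  have huser : ∀ᵐ ω ∂P, ∀ t, (ξ t ω).user ∈ S := by
    refine ae_all_iff.2 fun t => ?_
    refine ae_of_ae_map (p := fun z => z.user ∈ S) (hξ.measurable t).aemeasurable ?_
    rw [hξ.law t]
    exact slotLaw_user_notMem (fun i => (hr i).le) hr1 hq.le hq1 hs.le hs1 hπ0 hπn hπ1'
  have hage : ∀ᵐ ω ∂P, ∀ n, chainAt k (x₀.machine, h k + 1) (fun u => ξ u ω) n =
      ((stateAt x₀ (fun u => ξ u ω) (fun u => A u ω) (n + 1)).machine,
        age x₀ h (fun u => ξ u ω) (fun u => A u ω) k (n + 1)) := by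
    filter_upwards [huser, hQ] with ω h1 h2 n
    exact chainAt_eq x₀ h _ _ k (fun t ht => h2 t ht _ (h1 t)) n
  set y₀ : MachineState N × ℕ := (x₀.machine, h k + 1)
  have hlint : ∀ n : ℕ,
      ∫⁻ ω, (age x₀ h (fun u => ξ u ω) (fun u => A u ω) k (n + 1) : ℝ≥0∞) ∂P =
        ENNReal.ofReal (∫ ω, ((chainAt k y₀ (fun u => ξ u ω) n).2 : ℝ) ∂P) := by
    intro n
    rw [ofReal_integral_eq_lintegral_ofReal
      (integrable_chainAt hξ.measurable k y₀ n fun y => (y.2 : ℝ))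
      (ae_of_all _ fun ω => Nat.cast_nonneg _)]
    -- The arrivals need not be measurable: the age agrees almost surely with a function of the
    -- outcomes alone.
    refine lintegral_congr_ae ?_
    filter_upwards [hage] with ω hω
    simp [hω n]
  have hnn : ∀ n, 0 ≤ ∫ ω, ((chainAt k y₀ (fun u => ξ u ω) n).2 : ℝ) ∂P :=
    fun n => integral_nonneg fun ω => Nat.cast_nonneg _
  have hlim := tendsto_average_integral_age hq hq1 hs.le hs1 hr hr1 hμ hμ1 hπ hπ0 hπ1 hξ hk y₀
  -- The sign is not apparent from the closed form; it is inherited from the non-negative averages.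
  have hpos : 0 ≤ meanAge S μ π q s r k := ge_of_tendsto' hlim fun T =>
    div_nonneg (Finset.sum_nonneg fun n _ => hnn n) (Nat.cast_nonneg _)
  have havg : avgAge P x₀ h ξ A k = ENNReal.ofReal (meanAge S μ π q s r k) := by
    refine Tendsto.limsup_eq ((ENNReal.tendsto_ofReal hlim).congr' ?_)
    filter_upwards [eventually_gt_atTop 0] with T hT
    rw [ENNReal.ofReal_div_of_pos (by exact_mod_cast hT), ENNReal.ofReal_natCast,
      ENNReal.ofReal_sum_of_nonneg fun n _ => hnn n]
    congr 1
    -- Index `n` of the chain is slot `n + 1`, so `range T` shifts to the slots `1, …, T`.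
    rw [← Finset.sum_congr rfl fun n _ => hlint n, Finset.range_eq_Ico,
      Finset.sum_Ico_add' (fun t => ∫⁻ ω, (age x₀ h (fun u => ξ u ω) (fun u => A u ω) k t : ℝ≥0∞) ∂P)]
    rfl
  rw [havg, EReal.coe_ennreal_ofReal, max_eq_left hpos, meanAge]
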